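/- Write $\mathbb N_0=\{0,1,2,\dots\}$ and let $|\cdot|$ denote Lebesgue measure on $\mathbb R^2$. For $C\subset\mathbb N_0$ let $\mathcal F_C$ be the family of all dyadic rectangles $$\left[\tfrac{i-1}{2^{p}},\tfrac{i}{2^{p}}\right)\times\left[\tfrac{j-1}{2^{q}},\tfrac{j}{2^{q}}\right),\qquad p,q\in C,\ 1\le i\le 2^{p},\ 1\le j\le 2^{q}.$$ Let $C,D\subset\mathbb N_0$ with $C\neq\emptyset$, and suppose that $$\sup_{d\in D}\operatorname{dist}(d,C)=\infty ,\qquad \operatorname{dist}(d,C)=\min_{c\in C}|d-c| .$$ Then there is a function $\eta:\mathbb R\to\mathbb R$ with $\eta(\varepsilon)\to0$ as $\varepsilon\to0^+$ such that for every $\varepsilon>0$ and every $n=2^k$, $k\in\mathbb N_0$, there exist a function $f\in L^\infty([0,1)^2)$ with $f\ge0$ and $\|f\|_{L^1([0,1)^2)}\le 1+\eta(\varepsilon)$, and disjoint measurable sets $E,N\subset[0,1)^2$ with $|E|\ge 1/3$ and $|N|\le\varepsilon$, such that - for every $z\in E$ there is a rectangle $R\in\mathcal F_D$ with $z\in R$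 and $\frac1{|R|}\int_R f\,dx\,dy\ge \frac n2$; - for every $z\in[0,1)^2\setminus N$ and every $R\in\mathcal F_C$ with $z\in R$, $\frac1{|R|}\int_R f\,dx\,dy\le 3$. -/

import Mathlib

open MeasureTheory Filter Topology
open scoped ENNReal

/-- The half-open unit square `[0,1)²`. -/
def unitSquare : Set (ℝ × ℝ) := Set.Ico 0 1 ×ˢ Set.Ico 0 1

/-- The dyadic rectangle `R_{n,m}(i,j) = [(i-1)/2^n, i/2^n) × [(j-1)/2^m, j/2^m)`. -/
def dyadicRect (n m i j : ℕ) : Set (ℝ × ℝ) :=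
  Set.Ico (((i : ℝ) - 1) / 2 ^ n) ((i : ℝ) / 2 ^ n) ×ˢ
    Set.Ico (((j : ℝ) - 1) / 2 ^ m) ((j : ℝ) / 2 ^ m)

/-- The rare basis `F_C`: all dyadic rectangles in `[0,1)²` whose two side lengths are
`2^{-n}` and `2^{-m}` with `n, m ∈ C`. -/
def rareBasis (C : Set ℕ) : Set (Set (ℝ × ℝ)) :=
  {R | ∃ n ∈ C, ∃ m ∈ C, ∃ i ∈ Finset.Icc 1 (2 ^ n), ∃ j ∈ Finset.Icc 1 (2 ^ m),
    R = dyadicRect n m i j}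

/-!
The function is a product of factors `2 · 1[digit α of x = digit β of y]`, in which no digit of `x`
and no digit of `y` occurs twice. Switching one binary digit preserves Lebesgue measure and turns
the factor containing that digit into `2` minus itself. Hence, on a dyadic rectangle of level
`(p, q)`, every factor with `p < α` or `q < β` averages out to `1`, and the mean of the product is
the product of the remaining factors, which are constant on the rectangle
(`setAverage_matchProd`). In particular the total mass is `1`, so `η = 0` will do.

Let `n = 2 ^ k`. Choose `d 0 < d 1 < ⋯` in `D` far from `C` and from each other
(`exists_separated_seq`). Around each `d i` lies a block of digits `d i - k + 1, …, d i + L`. Every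
element of `C` has distance at least `k + L` from `d i`, so as a level it decides all digits of the
block or none. The `i`-th block of `x` is matched, digit by digit, with the
`i`-th block of `y` counted from the end of the list `d 0, …, d (n - 1)`. Because of the reversed
order, the level `(d i, d (n - 1 - i))` decides exactly the first `k` pairs of the `i`-th pair of
blocks and nothing else. The mean at this level is therefore `2 ^ k = n` on the event `G i` that
these `k` pairs agree. The events `G 0, …, G (n - 1)` are independent of probability `1 / n`, so
their union has measure `1 - (1 - 1 / n) ^ n ≥ 1 / 2`
(`volume_unitSquare_diff_iUnion_matchSet`).

A level in `C × C`, on the other hand, decides each pair of blocks entirely or leaves its factors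
averaged to `1`. Unless all `k + L` digits of some pair of blocks agree at `z`, the mean over a
rectangle of `F_C` around `z` is thus `0` or `1`. The exceptional set `N` where some pair of blocks
agrees entirely has measure at most `n * 2 ^ (-(k + L)) = 2 ^ (-L)`, and `E` is the union of the
`G i` with `N` removed.
-/

/-! ### Switching a binary digit -/

/-- The `m`-th binary digit of `x`, counted so that digits `1, 2, …` are those of the fractional
part. -/
noncomputable def binDigit (m : ℕ) (x : ℝ) : ℤ := ⌊(2 : ℝ) ^ m * x⌋ % 2

/-- The map of the line that switches the `m`-th binary digit and keeps all others. -/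
noncomputable def flipDigit (m : ℕ) (x : ℝ) : ℝ := x + (1 - 2 * binDigit m x : ℤ) / 2 ^ m

theorem binDigit_eq_zero_or_one (m : ℕ) (x : ℝ) : binDigit m x = 0 ∨ binDigit m x = 1 :=
  Int.emod_two_eq_zero_or_one _

theorem measurable_binDigit (m : ℕ) : Measurable (binDigit m) := by
  have h : Measurable fun a : ℤ => a % 2 := measurable_from_top
  exact h.comp (Int.measurable_floor.comp (measurable_const_mul _))

theorem measurable_flipDigit (m : ℕ) : Measurable (flipDigit m) := by
  have h : Measurable fun a : ℤ => ((1 - 2 * a : ℤ) : ℝ) / 2 ^ m := measurable_from_top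
  exact measurable_id.add (h.comp (measurable_binDigit m))

theorem floor_two_pow_mul_of_le {p m : ℕ} (h : p ≤ m) (x : ℝ) :
    ⌊(2 : ℝ) ^ p * x⌋ = ⌊(2 : ℝ) ^ m * x⌋ / 2 ^ (m - p) := by
  have := Int.floor_div_natCast ((2 : ℝ) ^ m * x) (2 ^ (m - p))
  push_cast at this
  rw [← this]
  congr 1
  obtain ⟨r, rfl⟩ := Nat.exists_eq_add_of_le h
  rw [Nat.add_sub_cancel_left, pow_add]
  field_simp

theorem binDigit_eq_of_floor_eq {m p : ℕ} (h : m ≤ p) {x y : ℝ}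
    (hxy : ⌊(2 : ℝ) ^ p * x⌋ = ⌊(2 : ℝ) ^ p * y⌋) : binDigit m x = binDigit m y := by
  rw [binDigit, binDigit, floor_two_pow_mul_of_le h, floor_two_pow_mul_of_le h y, hxy]

theorem floor_two_pow_mul_flipDigit (m : ℕ) (x : ℝ) :
    ⌊(2 : ℝ) ^ m * flipDigit m x⌋ = ⌊(2 : ℝ) ^ m * x⌋ + (1 - 2 * binDigit m x) := by
  have : (2 : ℝ) ^ m * flipDigit m x = 2 ^ m * x + ((1 - 2 * binDigit m x : ℤ) : ℝ) := by
    rw [flipDigit]; field_simp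
  rw [this, Int.floor_add_intCast]

theorem floor_flipDigit_of_lt {p m : ℕ} (h : p < m) (x : ℝ) :
    ⌊(2 : ℝ) ^ p * flipDigit m x⌋ = ⌊(2 : ℝ) ^ p * x⌋ := by
  obtain ⟨r, rfl⟩ := Nat.exists_eq_add_of_lt h
  rw [floor_two_pow_mul_of_le (m := p + r + 1) (by omega) (flipDigit _ x),
    floor_two_pow_mul_of_le (m := p + r + 1) (by omega) x, floor_two_pow_mul_flipDigit, binDigit,
    show (2 : ℤ) ^ (p + r + 1 - p) = 2 * 2 ^ r by
      rw [show p + r + 1 - p = r + 1 by omega, pow_succ, mul_comm],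
    ← Int.ediv_ediv_of_nonneg (by norm_num), ← Int.ediv_ediv_of_nonneg (by norm_num)]
  congr 1
  omega

theorem binDigit_flipDigit_self (m : ℕ) (x : ℝ) :
    binDigit m (flipDigit m x) = 1 - binDigit m x := by
  rw [binDigit, floor_two_pow_mul_flipDigit, binDigit]
  omega

theorem binDigit_flipDigit_of_ne {p m : ℕ} (h : p ≠ m) (x : ℝ) :
    binDigit p (flipDigit m x) = binDigit p x := by
  rcases lt_or_gt_of_ne h with h | h
  · rw [binDigit, floor_flipDigit_of_lt h, binDigit]
  · obtain ⟨r, rfl⟩ := Nat.exists_eq_add_of_lt h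
    have : (2 : ℝ) ^ (m + r + 1) * flipDigit m x =
        2 ^ (m + r + 1) * x + ((2 * (2 ^ r * (1 - 2 * binDigit m x)) : ℤ) : ℝ) := by
      rw [flipDigit]; push_cast; field_simp; ring
    rw [binDigit, this, Int.floor_add_intCast, Int.add_mul_emod_self_left, binDigit]

theorem flipDigit_flipDigit (m : ℕ) (x : ℝ) : flipDigit m (flipDigit m x) = x := by
  rw [flipDigit, binDigit_flipDigit_self, flipDigit]
  push_cast
  ring

/-- Switching a digit, as a measurable equivalence. -/
noncomputable def flipDigitEquiv (m : ℕ) : ℝ ≃ᵐ ℝ where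
  toFun := flipDigit m
  invFun := flipDigit m
  left_inv := flipDigit_flipDigit m
  right_inv := flipDigit_flipDigit m
  measurable_toFun := measurable_flipDigit m
  measurable_invFun := measurable_flipDigit m

/-- Switching a digit translates the points with digit `0` onto those with digit `1`, and
conversely. -/
theorem measurePreserving_flipDigit (m : ℕ) : MeasurePreserving (flipDigit m) := by
  refine ⟨measurable_flipDigit m, ?_⟩
  ext A hA
  rw [Measure.map_apply (measurable_flipDigit m) hA]
  have hD : MeasurableSet {x | binDigit m x = 0} := measurable_binDigit m (measurableSet_singleton 0)
  have hbranch : ∀ x, flipDigit m x =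
      if binDigit m x = 0 then x + 1 / 2 ^ m else x + (-1) / 2 ^ m := by
    intro x
    rcases binDigit_eq_zero_or_one m x with h | h <;> simp [flipDigit, h]
  have hfl : ∀ (x : ℝ) (a : ℤ), ⌊(2 : ℝ) ^ m * (x + a / 2 ^ m)⌋ = ⌊(2 : ℝ) ^ m * x⌋ + a := by
    intro x a
    rw [← Int.floor_add_intCast]
    congr 1
    field_simp
  have h1 : flipDigit m ⁻¹' A ∩ {x | binDigit m x = 0} =
      (fun x => x + 1 / 2 ^ m) ⁻¹' (A \ {x | binDigit m x = 0}) := by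
    ext x
    have := hfl x 1
    simp only [Int.cast_one] at this
    by_cases h : binDigit m x = 0
    · have h' : binDigit m (x + 1 / 2 ^ m) ≠ 0 := by
        rw [binDigit] at h ⊢; omega
      simp [hbranch, h] at h' ⊢
      simp [h']
    · have h' : binDigit m (x + 1 / 2 ^ m) = 0 := by
        rw [binDigit] at h ⊢; omega
      simp [h] at h' ⊢
      simp [h']
  have h2 : flipDigit m ⁻¹' A \ {x | binDigit m x = 0} =
      (fun x => x + (-1) / 2 ^ m) ⁻¹' (A ∩ {x | binDigit m x = 0}) := by
    ext x
    have := hfl x (-1)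
    simp only [Int.cast_neg, Int.cast_one] at this
    by_cases h : binDigit m x = 0
    · have h' : binDigit m (x + (-1) / 2 ^ m) ≠ 0 := by
        rw [binDigit] at h ⊢; omega
      simp [h, h']
    · have h' : binDigit m (x + (-1) / 2 ^ m) = 0 := by
        rw [binDigit] at h ⊢; omega
      simp [hbranch, h, h']
  rw [← measure_inter_add_sdiff _ hD, h1, h2, measure_preimage_add_right,
    measure_preimage_add_right, add_comm, measure_inter_add_sdiff _ hD]

/-! ### Dyadic rectangles -/

theorem mem_Ico_dyadic_iff (p i : ℕ) (x : ℝ) :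
    x ∈ Set.Ico (((i : ℝ) - 1) / 2 ^ p) ((i : ℝ) / 2 ^ p) ↔ ⌊(2 : ℝ) ^ p * x⌋ = (i : ℤ) - 1 := by
  rw [Int.floor_eq_iff, Set.mem_Ico, div_le_iff₀' (by positivity), lt_div_iff₀' (by positivity)]
  push_cast
  simp

theorem mem_dyadicRect_iff (p q i j : ℕ) (z : ℝ × ℝ) :
    z ∈ dyadicRect p q i j ↔
      ⌊(2 : ℝ) ^ p * z.1⌋ = (i : ℤ) - 1 ∧ ⌊(2 : ℝ) ^ q * z.2⌋ = (j : ℤ) - 1 := by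
  rw [dyadicRect, Set.mem_prod, mem_Ico_dyadic_iff, mem_Ico_dyadic_iff]

theorem measurableSet_dyadicRect (p q i j : ℕ) : MeasurableSet (dyadicRect p q i j) :=
  measurableSet_Ico.prod measurableSet_Ico

theorem volume_dyadicRect (p q i j : ℕ) :
    volume (dyadicRect p q i j) = ENNReal.ofReal (1 / 2 ^ p * (1 / 2 ^ q)) := by
  rw [dyadicRect, Measure.volume_eq_prod, Measure.prod_prod, Real.volume_Ico, Real.volume_Ico,
    ← ENNReal.ofReal_mul (by rw [← sub_div]; simp)]
  congr 1
  ring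

theorem volume_dyadicRect_ne_top (p q i j : ℕ) : volume (dyadicRect p q i j) ≠ ∞ := by
  rw [volume_dyadicRect]; exact ENNReal.ofReal_ne_top

theorem volume_real_dyadicRect_pos (p q i j : ℕ) : 0 < volume.real (dyadicRect p q i j) := by
  rw [Measure.real, volume_dyadicRect, ENNReal.toReal_ofReal (by positivity)]
  positivity

theorem dyadicRect_zero_zero : dyadicRect 0 0 1 1 = unitSquare := by
  simp [dyadicRect, unitSquare]

theorem measurableSet_unitSquare : MeasurableSet unitSquare :=
  measurableSet_Ico.prod measurableSet_Ico

theorem volume_unitSquare : volume unitSquare = 1 := by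
  rw [← dyadicRect_zero_zero, volume_dyadicRect]; simp

/-- Every level of the grid has a rectangle around a given point of the unit square. -/
theorem exists_mem_dyadicRect {z : ℝ × ℝ} (hz : z ∈ unitSquare) (p q : ℕ) :
    ∃ i ∈ Finset.Icc 1 (2 ^ p), ∃ j ∈ Finset.Icc 1 (2 ^ q), z ∈ dyadicRect p q i j := by
  have key : ∀ (p : ℕ) (x : ℝ), x ∈ Set.Ico (0 : ℝ) 1 →
      ∃ i ∈ Finset.Icc 1 (2 ^ p), ⌊(2 : ℝ) ^ p * x⌋ = ((i : ℕ) : ℤ) - 1 := by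
    rintro p x ⟨h0, h1⟩
    have hnn : (0 : ℤ) ≤ ⌊(2 : ℝ) ^ p * x⌋ := Int.floor_nonneg.2 (by positivity)
    have hlt : ⌊(2 : ℝ) ^ p * x⌋ < 2 ^ p := by
      rw [Int.floor_lt]
      push_cast
      exact mul_lt_of_lt_one_right (by positivity) h1
    obtain ⟨a, ha⟩ := Int.eq_ofNat_of_zero_le hnn
    refine ⟨a + 1, ?_, by rw [ha]; push_cast; ring⟩
    rw [ha] at hlt
    have : a < 2 ^ p := by exact_mod_cast hlt
    simp only [Finset.mem_Icc]
    omega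
  obtain ⟨i, hi, hi'⟩ := key p z.1 hz.1
  obtain ⟨j, hj, hj'⟩ := key q z.2 hz.2
  exact ⟨i, hi, j, hj, (mem_dyadicRect_iff ..).2 ⟨hi', hj'⟩⟩

/-! ### Products of digit matches -/

/-- Twice the indicator of the event that digit `a s` of the first coordinate agrees with digit
`b s` of the second. -/
noncomputable def matchFactor {ι : Type*} (a b : ι → ℕ) (s : ι) (z : ℝ × ℝ) : ℝ :=
  if binDigit (a s) z.1 = binDigit (b s) z.2 then 2 else 0

/-- The product of the matching factors over `S`: it is `2 ^ #S` where all pairs of digits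
indexed by `S` agree, and `0` elsewhere. -/
noncomputable def matchProd {ι : Type*} (a b : ι → ℕ) (S : Finset ι) (z : ℝ × ℝ) : ℝ :=
  ∏ s ∈ S, matchFactor a b s z

section
variable {ι : Type*} {a b : ι → ℕ}

theorem measurable_matchFactor (s : ι) : Measurable (matchFactor a b s) :=
  Measurable.ite (measurableSet_eq_fun ((measurable_binDigit _).comp measurable_fst)
    ((measurable_binDigit _).comp measurable_snd)) measurable_const measurable_const

theorem measurable_matchProd (S : Finset ι) : Measurable (matchProd a b S) :=
  Finset.measurable_fun_prod _ fun s _ => measurable_matchFactor s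

theorem matchFactor_nonneg (s : ι) (z : ℝ × ℝ) : 0 ≤ matchFactor a b s z := by
  unfold matchFactor; split_ifs <;> norm_num

theorem matchFactor_le_two (s : ι) (z : ℝ × ℝ) : matchFactor a b s z ≤ 2 := by
  unfold matchFactor; split_ifs <;> norm_num

theorem matchProd_nonneg (S : Finset ι) (z : ℝ × ℝ) : 0 ≤ matchProd a b S z :=
  Finset.prod_nonneg fun s _ => matchFactor_nonneg s z

theorem matchProd_le (S : Finset ι) (z : ℝ × ℝ) : matchProd a b S z ≤ 2 ^ S.card := by
  rw [matchProd, ← Finset.prod_const]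
  exact Finset.prod_le_prod (fun s _ => matchFactor_nonneg s z) fun s _ => matchFactor_le_two s z

theorem norm_matchProd_le (S : Finset ι) (z : ℝ × ℝ) : ‖matchProd a b S z‖ ≤ 2 ^ S.card := by
  rw [Real.norm_of_nonneg (matchProd_nonneg S z)]
  exact matchProd_le S z

theorem matchProd_eq_two_pow {S : Finset ι} {z : ℝ × ℝ}
    (h : ∀ s ∈ S, binDigit (a s) z.1 = binDigit (b s) z.2) : matchProd a b S z = 2 ^ S.card := by
  rw [matchProd, ← Finset.prod_const]
  exact Finset.prod_congr rfl fun s hs => if_pos (h s hs)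

theorem matchProd_eq_zero {S : Finset ι} {z : ℝ × ℝ} {s : ι} (hs : s ∈ S)
    (h : binDigit (a s) z.1 ≠ binDigit (b s) z.2) : matchProd a b S z = 0 :=
  Finset.prod_eq_zero hs (if_neg h)

theorem integrableOn_matchProd (S : Finset ι) {R : Set (ℝ × ℝ)} (hR : volume R ≠ ∞) :
    IntegrableOn (matchProd a b S) R := by
  have : IsFiniteMeasure (volume.restrict R) := ⟨by simpa using hR.lt_top⟩
  exact Integrable.of_bound (measurable_matchProd S).aestronglyMeasurable (2 ^ S.card)
    (Eventually.of_forall (norm_matchProd_le S))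

/-- A measure-preserving map of `R` that turns a match at `s` into a mismatch and conversely, and
leaves the other factors alone, shows that the factor at `s` averages out to `1`. -/
theorem setIntegral_matchProd_insert [DecidableEq ι] {S : Finset ι} {s : ι} (hs : s ∉ S)
    {R : Set (ℝ × ℝ)} (hR : volume R ≠ ∞) {F : ℝ × ℝ → ℝ × ℝ} (hF : MeasurePreserving F)
    (he : MeasurableEmbedding F) (hFR : F ⁻¹' R = R)
    (hself : ∀ z, matchFactor a b s (F z) = 2 - matchFactor a b s z)
    (hother : ∀ t ∈ S, ∀ z, matchFactor a b t (F z) = matchFactor a b t z) :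
    ∫ z in R, matchProd a b (insert s S) z = ∫ z in R, matchProd a b S z := by
  have h := hF.setIntegral_preimage_emb he (matchProd a b (insert s S)) R
  have hpt : ∀ z, matchProd a b (insert s S) (F z) =
      2 * matchProd a b S z - matchProd a b (insert s S) z := by
    intro z
    have : ∏ t ∈ S, matchFactor a b t (F z) = ∏ t ∈ S, matchFactor a b t z :=
      Finset.prod_congr rfl fun t ht => hother t ht z
    simp only [matchProd, Finset.prod_insert hs, hself, this]
    ring
  rw [hFR] at h
  simp only [hpt] at h
  rw [integral_sub ((integrableOn_matchProd S hR).const_mul 2) (integrableOn_matchProd _ hR),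
    integral_const_mul] at h
  linarith

theorem measurePreserving_flipDigit_fst (m : ℕ) :
    MeasurePreserving (Prod.map (flipDigit m) (id : ℝ → ℝ)) :=
  (measurePreserving_flipDigit m).prod (MeasurePreserving.id volume)

theorem measurePreserving_flipDigit_snd (m : ℕ) :
    MeasurePreserving (Prod.map (id : ℝ → ℝ) (flipDigit m)) :=
  (MeasurePreserving.id volume).prod (measurePreserving_flipDigit m)

theorem measurableEmbedding_flipDigit_fst (m : ℕ) :
    MeasurableEmbedding (Prod.map (flipDigit m) (id : ℝ → ℝ)) :=
  ((flipDigitEquiv m).prodCongr (.refl ℝ)).measurableEmbedding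

theorem measurableEmbedding_flipDigit_snd (m : ℕ) :
    MeasurableEmbedding (Prod.map (id : ℝ → ℝ) (flipDigit m)) :=
  ((MeasurableEquiv.refl ℝ).prodCongr (flipDigitEquiv m)).measurableEmbedding

/-- If no pair indexed by `S` has both of its digits determined on the rectangle, then the
product of the factors has mean `1` there. -/
theorem setIntegral_matchProd_of_unresolved [DecidableEq ι] {p q i j : ℕ} {S : Finset ι}
    (ha : Set.InjOn a S) (hb : Set.InjOn b S) (hS : ∀ s ∈ S, p < a s ∨ q < b s) :
    ∫ z in dyadicRect p q i j, matchProd a b S z = volume.real (dyadicRect p q i j) := by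
  induction S using Finset.induction_on with
  | empty => simp [matchProd]
  | insert s S hs ih =>
    have hne : ∀ t ∈ S, a t ≠ a s ∧ b t ≠ b s := by
      intro t ht
      have hts : t ≠ s := fun h => hs (h ▸ ht)
      exact ⟨fun h => hts (ha (by simp [ht]) (by simp) h),
        fun h => hts (hb (by simp [ht]) (by simp) h)⟩
    have hsub : (S : Set ι) ⊆ (insert s S : Finset ι) := by simp
    rw [← ih (ha.mono hsub) (hb.mono hsub) fun t ht => hS t (Finset.mem_insert_of_mem ht)]
    rcases hS s (Finset.mem_insert_self s S) with h | h
    · refine setIntegral_matchProd_insert hs (volume_dyadicRect_ne_top p q i j)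
        (measurePreserving_flipDigit_fst (a s)) (measurableEmbedding_flipDigit_fst (a s)) ?_ ?_ ?_
      · ext z
        simp [mem_dyadicRect_iff, floor_flipDigit_of_lt h]
      · intro z
        simp only [matchFactor, Prod.map_fst, Prod.map_snd, id, binDigit_flipDigit_self]
        rcases binDigit_eq_zero_or_one (a s) z.1 with h1 | h1 <;>
          rcases binDigit_eq_zero_or_one (b s) z.2 with h2 | h2 <;> simp [h1, h2]
      · intro t ht z
        simp [matchFactor, binDigit_flipDigit_of_ne (hne t ht).1]
    · refine setIntegral_matchProd_insert hs (volume_dyadicRect_ne_top p q i j)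
        (measurePreserving_flipDigit_snd (b s)) (measurableEmbedding_flipDigit_snd (b s)) ?_ ?_ ?_
      · ext z
        simp [mem_dyadicRect_iff, floor_flipDigit_of_lt h]
      · intro z
        simp only [matchFactor, Prod.map_fst, Prod.map_snd, id, binDigit_flipDigit_self]
        rcases binDigit_eq_zero_or_one (a s) z.1 with h1 | h1 <;>
          rcases binDigit_eq_zero_or_one (b s) z.2 with h2 | h2 <;> simp [h1, h2]
      · intro t ht z
        simp [matchFactor, binDigit_flipDigit_of_ne (hne t ht).2]

/-- The mean of the product over a dyadic rectangle is the product of the factors whose two digits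
are determined on the rectangle, evaluated at any of its points. -/
theorem setAverage_matchProd [DecidableEq ι] {p q i j : ℕ} {S : Finset ι}
    (ha : Set.InjOn a S) (hb : Set.InjOn b S) {z : ℝ × ℝ} (hz : z ∈ dyadicRect p q i j) :
    ⨍ w in dyadicRect p q i j, matchProd a b S w =
      matchProd a b (S.filter fun s => a s ≤ p ∧ b s ≤ q) z := by
  set T := S.filter fun s => a s ≤ p ∧ b s ≤ q
  set T' := S.filter fun s => ¬ (a s ≤ p ∧ b s ≤ q)
  have hT' : (T' : Set ι) ⊆ S := by exact_mod_cast Finset.filter_subset _ S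
  have hpt : ∀ w ∈ dyadicRect p q i j,
      matchProd a b S w = matchProd a b T z * matchProd a b T' w := by
    intro w hw
    rw [mem_dyadicRect_iff] at hz hw
    have : matchProd a b T z = matchProd a b T w := by
      refine Finset.prod_congr rfl fun s hs => ?_
      obtain ⟨-, h1, h2⟩ := Finset.mem_filter.1 hs
      rw [matchFactor, matchFactor, binDigit_eq_of_floor_eq h1 (hz.1.trans hw.1.symm),
        binDigit_eq_of_floor_eq h2 (hz.2.trans hw.2.symm)]
    rw [this]
    exact (Finset.prod_filter_mul_prod_filter_not S _ _).symm
  rw [setAverage_eq, setIntegral_congr_fun (measurableSet_dyadicRect ..) hpt, integral_const_mul,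
    setIntegral_matchProd_of_unresolved (ha.mono hT') (hb.mono hT'), smul_eq_mul]
  · have := (volume_real_dyadicRect_pos p q i j).ne'
    field_simp
  · intro s hs
    have := (Finset.mem_filter.1 hs).2
    omega

theorem setIntegral_unitSquare_matchProd [DecidableEq ι] {S : Finset ι}
    (ha : Set.InjOn a S) (hb : Set.InjOn b S) (hpos : ∀ s ∈ S, 0 < a s) :
    ∫ z in unitSquare, matchProd a b S z = 1 := by
  rw [← dyadicRect_zero_zero,
    setIntegral_matchProd_of_unresolved ha hb fun s hs => Or.inl (hpos s hs), Measure.real,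
    volume_dyadicRect]
  simp

/-! ### Probabilities of agreement -/

/-- The set of points whose digits agree for all pairs indexed by `S`. -/
def matchSet (a b : ι → ℕ) (S : Finset ι) : Set (ℝ × ℝ) :=
  {z | ∀ s ∈ S, binDigit (a s) z.1 = binDigit (b s) z.2}

theorem measurableSet_matchSet (S : Finset ι) : MeasurableSet (matchSet a b S) := by
  have : matchSet a b S = ⋂ s ∈ S, {z | binDigit (a s) z.1 = binDigit (b s) z.2} := by
    ext; simp [matchSet]
  rw [this]
  exact Finset.measurableSet_biInter _ fun s _ =>
    measurableSet_eq_fun ((measurable_binDigit _).comp measurable_fst)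
      ((measurable_binDigit _).comp measurable_snd)

theorem indicator_matchSet (S : Finset ι) (z : ℝ × ℝ) :
    (matchSet a b S).indicator 1 z = (2 ^ S.card : ℝ)⁻¹ * matchProd a b S z := by
  by_cases h : z ∈ matchSet a b S
  · rw [Set.indicator_of_mem h, matchProd_eq_two_pow h]
    simp
  · rw [Set.indicator_of_notMem h]
    simp only [matchSet, Set.mem_ofPred_eq, not_forall] at h
    obtain ⟨s, hs, h⟩ := h
    rw [matchProd_eq_zero hs h, mul_zero]

theorem volume_unitSquare_inter_matchSet [DecidableEq ι] {S : Finset ι}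
    (ha : Set.InjOn a S) (hb : Set.InjOn b S) (hpos : ∀ s ∈ S, 0 < a s) :
    volume (unitSquare ∩ matchSet a b S) = ENNReal.ofReal (2 ^ S.card : ℝ)⁻¹ := by
  have hfin : volume (unitSquare ∩ matchSet a b S) ≠ ∞ :=
    measure_ne_top_of_subset Set.inter_subset_left (by simp [volume_unitSquare])
  rw [← ENNReal.ofReal_toReal hfin]
  congr 1
  have h := setIntegral_indicator (μ := volume) (s := unitSquare)
    (f := fun _ : ℝ × ℝ => (1 : ℝ)) (measurableSet_matchSet (a := a) (b := b) S)
  rw [setIntegral_const, smul_eq_mul, mul_one] at h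
  have hpt : (matchSet a b S).indicator (fun _ : ℝ × ℝ => (1 : ℝ)) =
      fun z => (2 ^ S.card : ℝ)⁻¹ * matchProd a b S z := funext (indicator_matchSet S)
  rw [← Measure.real, ← h, hpt, integral_const_mul,
    setIntegral_unitSquare_matchProd ha hb hpos, mul_one]

/-- Agreements on disjoint families of `k` pairs of digits are independent events of probability
`2⁻ᵏ`. -/
theorem volume_unitSquare_diff_iUnion_matchSet [DecidableEq ι] {κ : Type*} [DecidableEq κ]
    {S : Finset ι} (ha : Set.InjOn a S) (hb : Set.InjOn b S) (hpos : ∀ s ∈ S, 0 < a s)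
    (I : Finset κ) (B : κ → Finset ι) (hB : ∀ i ∈ I, B i ⊆ S)
    (hdisj : (I : Set κ).PairwiseDisjoint B) {k : ℕ} (hk : ∀ i ∈ I, (B i).card = k) :
    volume.real (unitSquare \ ⋃ i ∈ I, matchSet a b (B i)) = (1 - (2 ^ k : ℝ)⁻¹) ^ I.card := by
  have hmeas : MeasurableSet (⋃ i ∈ I, matchSet a b (B i)) :=
    Finset.measurableSet_biUnion _ fun i _ => measurableSet_matchSet _
  have h := setIntegral_indicator (μ := volume) (s := unitSquare)
    (f := fun _ : ℝ × ℝ => (1 : ℝ)) hmeas.compl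
  rw [setIntegral_const, smul_eq_mul, mul_one, ← Set.sdiff_eq] at h
  -- The indicator of the complement of the union is expanded by inclusion and exclusion.
  have hpt : ∀ z, (⋃ i ∈ I, matchSet a b (B i))ᶜ.indicator (fun _ : ℝ × ℝ => (1 : ℝ)) z =
      ∑ J ∈ I.powerset, (-(2 ^ k : ℝ)⁻¹) ^ J.card * matchProd a b (J.biUnion B) z := by
    intro z
    have h1 : (⋃ i ∈ I, matchSet a b (B i))ᶜ.indicator (fun _ : ℝ × ℝ => (1 : ℝ)) z =
        ∏ i ∈ I, (1 + -(matchSet a b (B i)).indicator 1 z) := by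
      by_cases hz : z ∈ ⋃ i ∈ I, matchSet a b (B i)
      · rw [Set.indicator_of_notMem (by simpa using hz)]
        simp only [Set.mem_iUnion, exists_prop] at hz
        obtain ⟨i, hi, hz⟩ := hz
        rw [Finset.prod_eq_zero hi]
        simp [hz]
      · rw [Set.indicator_of_mem (by simpa using hz), Finset.prod_eq_one]
        intro i hi
        have : z ∉ matchSet a b (B i) := fun h => hz (Set.mem_biUnion hi h)
        simp [this]
    rw [h1, Finset.prod_one_add]
    refine Finset.sum_congr rfl fun J hJ => ?_
    have hJI := Finset.mem_powerset.1 hJ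
    rw [matchProd, Finset.prod_biUnion (hdisj.subset (by exact_mod_cast hJI)),
      ← Finset.prod_const, ← Finset.prod_mul_distrib]
    refine Finset.prod_congr rfl fun i hi => ?_
    rw [indicator_matchSet, hk i (hJI hi), matchProd]
    ring
  rw [← h, integral_congr_ae (Eventually.of_forall hpt), integral_finsetSum]
  · have hJ : ∀ J ∈ I.powerset, ∫ z in unitSquare, (-(2 ^ k : ℝ)⁻¹) ^ J.card *
        matchProd a b (J.biUnion B) z = ∏ _i ∈ J, (-(2 ^ k : ℝ)⁻¹) := by
      intro J hJ
      have hsub : J.biUnion B ⊆ S :=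
        Finset.biUnion_subset.2 fun i hi => hB i (Finset.mem_powerset.1 hJ hi)
      have hsub' : ((J.biUnion B : Finset ι) : Set ι) ⊆ S := by exact_mod_cast hsub
      rw [integral_const_mul, setIntegral_unitSquare_matchProd (ha.mono hsub') (hb.mono hsub')
        fun s hs => hpos s (hsub hs), mul_one, Finset.prod_const]
    rw [Finset.sum_congr rfl hJ, ← Finset.prod_one_add, Finset.prod_const, sub_eq_add_neg]
  · intro J _
    exact (integrableOn_matchProd _ (by simp [volume_unitSquare])).const_mul _

end

/-! ### Separated elements of `D` -/

/-- `D` contains elements arbitrarily far from `C`; since `C` is nonempty these are also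
arbitrarily large. -/
theorem exists_far_from {C D : Set ℕ} (hC : C.Nonempty)
    (hCD : (⨆ n ∈ D, Metric.infEDist n C) = (∞ : ℝ≥0∞)) (K M : ℕ) :
    ∃ d ∈ D, M ≤ d ∧ ∀ c ∈ C, c + K ≤ d ∨ d + K ≤ c := by
  obtain ⟨c₀, hc₀⟩ := hC
  have hlt : ((K + M + c₀ : ℕ) : ℝ≥0∞) < ⨆ n ∈ D, Metric.infEDist n C := by
    rw [hCD]; exact ENNReal.natCast_lt_top _
  obtain ⟨d, hd⟩ := lt_iSup_iff.1 hlt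
  obtain ⟨hdD, hd⟩ := lt_iSup_iff.1 hd
  have hfar : ∀ c ∈ C, c + (K + M + c₀) ≤ d ∨ d + (K + M + c₀) ≤ c := by
    intro c hc
    have h := hd.trans_le (Metric.infEDist_le_edist_of_mem hc)
    rw [edist_dist, Nat.dist_eq, ← ENNReal.ofReal_natCast,
      ENNReal.ofReal_lt_ofReal_iff_of_nonneg (by positivity)] at h
    by_contra! hcon
    have h1 : (d : ℝ) < c + (K + M + c₀ : ℕ) := by exact_mod_cast hcon.1
    have h2 : (c : ℝ) < d + (K + M + c₀ : ℕ) := by exact_mod_cast hcon.2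
    exact absurd (abs_sub_lt_iff.2 ⟨by linarith, by linarith⟩) (not_lt.2 h.le)
  refine ⟨d, hdD, ?_, fun c hc => ?_⟩
  · have := hfar c₀ hc₀
    omega
  · have := hfar c hc
    omega

/-- Widely separated elements of `D` that are far from `C`. -/
theorem exists_separated_seq {C D : Set ℕ} (hC : C.Nonempty)
    (hCD : (⨆ n ∈ D, Metric.infEDist n C) = (∞ : ℝ≥0∞)) (K : ℕ) :
    ∃ d : ℕ → ℕ, (∀ i, d i ∈ D) ∧ (∀ i, K ≤ d i) ∧ (∀ i j, i < j → d i + 2 * K ≤ d j) ∧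
      ∀ i, ∀ c ∈ C, c + K ≤ d i ∨ d i + K ≤ c := by
  choose e heD heM heC using exists_far_from hC hCD K
  set d : ℕ → ℕ := fun i => Nat.rec (e K) (fun _ x => e (x + 2 * K)) i with hd
  have hsucc : ∀ i, d (i + 1) = e (d i + 2 * K) := fun i => rfl
  have hstep : ∀ i, d i + 2 * K ≤ d (i + 1) := fun i => by rw [hsucc]; exact heM _
  have hmono : Monotone d := monotone_nat_of_le_succ fun i => by have := hstep i; omega
  refine ⟨d, fun i => ?_, fun i => (heM K).trans (hmono (Nat.zero_le i)),
    fun i j hij => (hstep i).trans (hmono hij), fun i => ?_⟩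
  · cases i with
    | zero => exact heD _
    | succ i => rw [hsucc]; exact heD _
  · cases i with
    | zero => exact heC _
    | succ i => rw [hsucc]; exact heC _

/-! ### The example -/

theorem one_sub_inv_pow_self_le {n : ℕ} (hn : 1 ≤ n) : (1 - (n : ℝ)⁻¹) ^ n ≤ 1 / 2 := by
  have hn' : (1 : ℝ) ≤ n := by exact_mod_cast hn
  have h := Real.one_sub_div_pow_le_exp_neg (n := n) (t := 1) hn'
  rw [one_div] at h
  refine h.trans ?_
  rw [Real.exp_neg, one_div]
  exact inv_anti₀ (by norm_num) Real.exp_one_gt_two.le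

theorem mainTheorem4 (C D : Set ℕ) (hC : C.Nonempty)
    (hCD : (⨆ n ∈ D, Metric.infEDist n C) = (∞ : ℝ≥0∞)) :
    ∃ η : ℝ → ℝ, Tendsto η (𝓝[>] 0) (𝓝 0) ∧
      ∀ ε : ℝ, 0 < ε → ∀ n : ℕ, (∃ k : ℕ, n = 2 ^ k) →
        ∃ f : ℝ × ℝ → ℝ,
          MemLp f ∞ (volume.restrict unitSquare) ∧
          (∀ z ∈ unitSquare, 0 ≤ f z) ∧
          eLpNorm f 1 (volume.restrict unitSquare) ≤ ENNReal.ofReal (1 + η ε) ∧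
          ∃ E N : Set (ℝ × ℝ),
            MeasurableSet E ∧ MeasurableSet N ∧
            E ⊆ unitSquare ∧ N ⊆ unitSquare ∧ Disjoint E N ∧
            1 / 3 ≤ volume E ∧ volume N ≤ ENNReal.ofReal ε ∧
            (∀ z ∈ E, ∃ R ∈ rareBasis D, z ∈ R ∧ (n : ℝ) / 2 ≤ (⨍ w in R, f w)) ∧
            (∀ z ∈ unitSquare \ N, ∀ R ∈ rareBasis C, z ∈ R → (⨍ w in R, f w) ≤ 3) := by
  refine ⟨fun _ => 0, tendsto_const_nhds, ?_⟩
  rintro ε hε n ⟨k, rfl⟩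
  -- The bound `1 / 6` leaves measure `1 / 2 - 1 / 6 = 1 / 3` for `E`.
  obtain ⟨L, hL⟩ := exists_pow_lt_of_lt_one (lt_min hε (by norm_num : (0 : ℝ) < 1 / 6))
    (by norm_num : (2 : ℝ)⁻¹ < 1)
  have hLε : ((2 : ℝ)⁻¹) ^ L ≤ ε := (hL.trans_le (min_le_left _ _)).le
  have hL6 : ((2 : ℝ)⁻¹) ^ L ≤ 1 / 6 := (hL.trans_le (min_le_right _ _)).le
  obtain ⟨d, hdD, hdK, hsep, hdC⟩ := exists_separated_seq hC hCD (k + L)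
  set n := 2 ^ k with hn
  have hn1 : 1 ≤ n := Nat.one_le_two_pow
  -- The pair `(i, m)` ties digit `m` of the `i`-th block of the first coordinate to that of the
  -- `i`-th block from the end of the second; each block consists of the digits
  -- `d i - k + 1, …, d i + L`.
  set a : ℕ × ℕ → ℕ := fun s => d s.1 + 1 + s.2 - k with ha_def
  set b : ℕ × ℕ → ℕ := fun s => d (n - 1 - s.1) + 1 + s.2 - k with hb_def
  set S : Finset (ℕ × ℕ) := Finset.range n ×ˢ Finset.range (k + L) with hS_def
  have hmemS : ∀ s : ℕ × ℕ, s ∈ S ↔ s.1 < n ∧ s.2 < k + L := by simp [hS_def, Finset.mem_product]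
  have hblock : ∀ i j m m', m < k + L → m' < k + L → d i + 1 + m - k = d j + 1 + m' - k →
      i = j ∧ m = m' := by
    intro i j m m' hm hm' h
    have h1 := hdK i
    have h2 := hdK j
    have hij : i = j := by
      by_contra hne
      rcases lt_or_gt_of_ne hne with hlt | hlt
      · have := hsep i j hlt; omega
      · have := hsep j i hlt; omega
    subst hij
    exact ⟨rfl, by omega⟩
  have ha : Set.InjOn a S := by
    rintro ⟨i, m⟩ hs ⟨j, m'⟩ ht h
    have hs := (hmemS _).1 hs
    have ht := (hmemS _).1 ht
    obtain ⟨rfl, rfl⟩ := hblock i j m m' hs.2 ht.2 h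
    rfl
  have hb : Set.InjOn b S := by
    rintro ⟨i, m⟩ hs ⟨j, m'⟩ ht h
    have hs := (hmemS _).1 hs
    have ht := (hmemS _).1 ht
    obtain ⟨h1, rfl⟩ := hblock (n - 1 - i) (n - 1 - j) m m' hs.2 ht.2 h
    simp only at hs ht
    obtain rfl : i = j := by omega
    rfl
  have hpos : ∀ s ∈ S, 0 < a s := fun s _ => by
    have := hdK s.1
    simp only [ha_def]; omega
  -- The first `l` pairs of block `i`.
  set B : ℕ → ℕ → Finset (ℕ × ℕ) := fun l i => {i} ×ˢ Finset.range l with hB_def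
  have hmemB : ∀ l i (s : ℕ × ℕ), s ∈ B l i ↔ s.1 = i ∧ s.2 < l := by
    simp only [hB_def, Finset.mem_product, Finset.mem_singleton, Finset.mem_range, implies_true]
  have hBcard : ∀ l i, (B l i).card = l := by simp [hB_def]
  have hBS : ∀ l i, l ≤ k + L → i < n → B l i ⊆ S := by
    intro l i hl hi s hs
    obtain ⟨rfl, h⟩ := (hmemB _ _ _).1 hs
    exact (hmemS s).2 ⟨hi, by omega⟩
  set G : Set (ℝ × ℝ) := ⋃ i ∈ Finset.range n, matchSet a b (B k i) with hG_def
  set N : Set (ℝ × ℝ) := ⋃ i ∈ Finset.range n, unitSquare ∩ matchSet a b (B (k + L) i) with hN_def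
  have hGm : MeasurableSet G := Finset.measurableSet_biUnion _ fun i _ => measurableSet_matchSet _
  have hNm : MeasurableSet N := Finset.measurableSet_biUnion _ fun i _ =>
    measurableSet_unitSquare.inter (measurableSet_matchSet _)
  have hNvol : volume N ≤ ENNReal.ofReal ((2 : ℝ)⁻¹ ^ L) := by
    refine (measure_biUnion_finset_le _ _).trans ?_
    have hi : ∀ i ∈ Finset.range n, volume (unitSquare ∩ matchSet a b (B (k + L) i)) =
        ENNReal.ofReal (2 ^ (k + L) : ℝ)⁻¹ := by
      intro i hi
      have hsub := hBS (k + L) i le_rfl (Finset.mem_range.1 hi)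
      have hsub' : (B (k + L) i : Set (ℕ × ℕ)) ⊆ S := by exact_mod_cast hsub
      rw [volume_unitSquare_inter_matchSet (ha.mono hsub') (hb.mono hsub')
        fun s hs => hpos s (hsub hs), hBcard]
    rw [Finset.sum_congr rfl hi, Finset.sum_const, Finset.card_range, ← ENNReal.ofReal_nsmul]
    refine ENNReal.ofReal_le_ofReal (le_of_eq ?_)
    rw [nsmul_eq_mul, hn, pow_add, inv_pow]
    push_cast
    field_simp
  have hGvol : volume.real (unitSquare \ G) ≤ 1 / 2 := by
    rw [hG_def, volume_unitSquare_diff_iUnion_matchSet ha hb hpos (Finset.range n) (B k)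
      (fun i hi => hBS k i (by omega) (Finset.mem_range.1 hi)) ?_ fun i _ => hBcard k i,
      Finset.card_range]
    · have := one_sub_inv_pow_self_le hn1
      rw [hn] at this ⊢
      exact_mod_cast this
    · intro i _ j _ hij
      refine Finset.disjoint_left.2 fun s hs ht => hij ?_
      rw [← ((hmemB _ _ _).1 hs).1, ← ((hmemB _ _ _).1 ht).1]
  have hfin : volume unitSquare ≠ ∞ := by simp [volume_unitSquare]
  have hprob : IsFiniteMeasure (volume.restrict unitSquare) := ⟨by simp [volume_unitSquare]⟩
  refine ⟨matchProd a b S, memLp_top_of_bound (measurable_matchProd S).aestronglyMeasurable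
    (2 ^ S.card) (Eventually.of_forall (norm_matchProd_le S)),
    fun z _ => matchProd_nonneg S z, ?_, (unitSquare ∩ G) \ N, N,
    (measurableSet_unitSquare.inter hGm).diff hNm, hNm,
    Set.sdiff_subset.trans Set.inter_subset_left,
    Set.iUnion₂_subset fun i _ => Set.inter_subset_left, Set.disjoint_sdiff_left, ?_,
    hNvol.trans (ENNReal.ofReal_le_ofReal hLε), ?_, ?_⟩
  · rw [add_zero, eLpNorm_one_eq_lintegral_enorm,
      ← ofReal_integral_norm_eq_lintegral_enorm (integrableOn_matchProd S hfin)]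
    simp only [Real.norm_of_nonneg (matchProd_nonneg S _)]
    rw [setIntegral_unitSquare_matchProd ha hb hpos]
  · have hsub : unitSquare ⊆ ((unitSquare ∩ G) \ N) ∪ ((unitSquare \ G) ∪ N) := by
      intro z hz
      by_cases h1 : z ∈ G <;> by_cases h2 : z ∈ N <;> simp [hz, h1, h2]
    have hNtop : volume N ≠ ∞ := (hNvol.trans_lt ENNReal.ofReal_lt_top).ne
    have hDtop : volume (unitSquare \ G) ≠ ∞ := measure_ne_top_of_subset Set.sdiff_subset hfin
    have hEtop : volume ((unitSquare ∩ G) \ N) ≠ ∞ :=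
      measure_ne_top_of_subset (Set.sdiff_subset.trans Set.inter_subset_left) hfin
    have hN6 : volume.real N ≤ 1 / 6 :=
      (ENNReal.toReal_le_of_le_ofReal (by positivity) hNvol).trans hL6
    have h1 := (measureReal_mono (μ := volume) hsub).trans (measureReal_union_le _ _)
    have h2 := measureReal_union_le (μ := volume) (unitSquare \ G) N
    have h3 : volume.real unitSquare = 1 := by simp [Measure.real, volume_unitSquare]
    have h4 : 1 / 3 ≤ volume.real ((unitSquare ∩ G) \ N) := by linarith
    rw [← ENNReal.ofReal_toReal hEtop, show (1 / 3 : ℝ≥0∞) = ENNReal.ofReal (1 / 3) by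
      rw [ENNReal.ofReal_div_of_pos (by norm_num)]; simp]
    exact ENNReal.ofReal_le_ofReal h4
  · rintro z ⟨⟨hz, hzG⟩, -⟩
    simp only [hG_def, Set.mem_iUnion, exists_prop, Finset.mem_range] at hzG
    obtain ⟨i, hi, hzi⟩ := hzG
    obtain ⟨x, hx, y, hy, hR⟩ := exists_mem_dyadicRect hz (d i) (d (n - 1 - i))
    refine ⟨_, ⟨d i, hdD _, d (n - 1 - i), hdD _, x, hx, y, hy, rfl⟩, hR, ?_⟩
    rw [setAverage_matchProd ha hb hR]
    -- Blocks before `i` are unresolved in the second coordinate and blocks after `i` in the first.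
    have hres : (S.filter fun s => a s ≤ d i ∧ b s ≤ d (n - 1 - i)) = B k i := by
      ext ⟨j, m⟩
      rw [Finset.mem_filter, hmemS, hmemB]
      simp only [ha_def, hb_def]
      have hj := hdK j
      have hj' := hdK (n - 1 - j)
      constructor
      · rintro ⟨⟨h1, h2⟩, h3, h4⟩
        have hij : j = i := by
          by_contra hne
          rcases lt_or_gt_of_ne hne with hlt | hlt
          · have := hsep (n - 1 - i) (n - 1 - j) (by omega); omega
          · have := hsep i j hlt; omega
        subst hij
        exact ⟨rfl, by omega⟩
      · rintro ⟨rfl, h⟩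
        exact ⟨⟨hi, by omega⟩, by omega, by omega⟩
    rw [hres, matchProd_eq_two_pow hzi, hBcard, hn]
    push_cast
    have : (0 : ℝ) < 2 ^ k := by positivity
    linarith
  · rintro z ⟨hz, hzN⟩ R ⟨p, hp, q, hq, x, -, y, -, rfl⟩ hzR
    rw [setAverage_matchProd ha hb hzR]
    rcases Finset.eq_empty_or_nonempty (S.filter fun s => a s ≤ p ∧ b s ≤ q) with h | ⟨⟨i, m⟩, h⟩
    · rw [h]; simp [matchProd]
    · -- Levels in `C` resolve a block entirely or not at all.
      rw [Finset.mem_filter, hmemS] at h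
      simp only [ha_def, hb_def] at h
      obtain ⟨⟨hi, hm⟩, h1, h2⟩ := h
      have hpi := hdC i p hp
      have hqi := hdC (n - 1 - i) q hq
      have hmis : z ∉ matchSet a b (B (k + L) i) := fun hmem =>
        hzN (Set.mem_biUnion (Finset.mem_coe.2 (Finset.mem_range.2 hi)) ⟨hz, hmem⟩)
      simp only [matchSet, Set.mem_ofPred_eq, not_forall] at hmis
      obtain ⟨⟨j, m'⟩, hs, hne⟩ := hmis
      obtain ⟨hj, hm'⟩ := (hmemB _ _ _).1 hs
      simp only at hj hm'
      subst hj
      rw [matchProd_eq_zero (s := (j, m')) ?_ hne]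
      · norm_num
      · rw [Finset.mem_filter, hmemS]
        simp only [ha_def, hb_def]
        omega
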